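/- Let $\mathbb R^n$ carry an inner product $\langle\cdot,\cdot\rangle$ with induced norm $\|\cdot\|$. Let $g:\mathbb R^n\to\mathbb R\cup\{\infty\}$ be proper, lower semicontinuous and convex, with $\operatorname{dom} g=\{x: g(x)<\infty\}$, and let $F:\mathbb R^n\to\mathbb R^n$ be Lipschitz continuous with constant $L>0$ on $\mathbb R^n$ and strongly monotone with modulus $\mu>0$ on $\operatorname{dom} g$, i.e. $\langle F(x)-F(y),x-y\rangle\ge\mu\|x-y\|^2$ for all $x,y\in\operatorname{dom} g$. Let $\kappa_1,\kappa_2>0$. For $\lambda>0$ put $$y(x)=\operatorname{prox}_{\lambda g}(x-\lambda F(x)),\qquad \operatorname{prox}_{w}(x)=\operatorname*{arg\,min}_{z\in\mathbb R^n}\Big(w(z)+\tfrac12\|x-z\|^2\Big),$$ and, for $\xi>2$, $\alpha_1=1-\frac2\xi$, $\alpha_2=1+\frac2\xi$, put $\rho(x)=0$ if $y(x)=x$ and $$\rho(x)=\frac{\kappa_1}{\|x-y(x)\|^{1-\alpha_1}}+\frac{\kappa_2}{\|x-y(x)\|^{1-\alpha_2}}\quad\text{otherwise.}$$ Then there is exactly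 one $x^*\in\operatorname{dom} g$ with $\langle F(x^*),x-x^*\rangle+g(x)-g(x^*)\ge0$ for all $x\in\mathbb R^n$, and the following holds. For every $\lambda\in\left(0,\frac{2\mu}{L^2}\right)$ there exist $\xi>2$ and $a,b>0$ such that for every $x_0\in\mathbb R^n$ and every $\epsilon>0$ there exists $\eta^*>0$ such that for every $\eta\in(0,\eta^*]$ the sequence $$x_{k+1}=x_k-\eta\,\rho(x_k)\,(x_k-y(x_k)),\qquad k\ge 0,$$ started at $x_0$ satisfies, with $k^*=\left\lceil\frac{\xi\pi}{2\eta\sqrt{ab}}\right\rceil$, $$\|x_k-x^*\|<\sqrt2\left(\sqrt{\tfrac ab}\,\tan\Big(\tfrac\pi2-\tfrac{\sqrt{ab}}{\xi}\eta k\Big)\right)^{\xi/2}+\epsilon\quad\text{for }1\le k<k^*,\qquad \|x_k-x^*\|<\epsilon\quad\text{for all }k\ge k^*.$$ -/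

import Mathlib

noncomputable section

namespace MVIP

variable {E : Type*} [NormedAddCommGroup E] [InnerProductSpace ℝ E]

/-- The effective domain of an extended-real-valued function. -/
def dom (g : E → EReal) : Set E := {x | g x < ⊤}

/-- `g : E → ℝ ∪ {∞}` is proper, lower semicontinuous and convex. -/
structure IsProperLscConvex (g : E → EReal) : Prop where
  ne_bot : ∀ x, g x ≠ ⊥
  proper : (dom g).Nonempty
  lsc : LowerSemicontinuous g
  convex : ∀ x y : E, ∀ s t : ℝ, 0 ≤ s → 0 ≤ t → s + t = 1 →
    g (s • x + t • y) ≤ (s : EReal) * g x + (t : EReal) * g y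

/-- `F` is strongly monotone with modulus `μ` on the set `S`. -/
def StronglyMonotoneOn (F : E → E) (S : Set E) (μ : ℝ) : Prop :=
  0 < μ ∧ ∀ x ∈ S, ∀ y ∈ S, μ * ‖x - y‖ ^ 2 ≤ inner ℝ (F x - F y) (x - y)

/-- `F` is Lipschitz continuous with Lipschitz constant `L`. -/
def IsLipschitz (F : E → E) (L : ℝ) : Prop :=
  0 < L ∧ ∀ x y, ‖F x - F y‖ ≤ L * ‖x - y‖

/-- `xs` solves the mixed variational inequality problem `MVI(F, g)`:
`xs ∈ dom g` and `⟨F xs, x - xs⟩ + g x - g xs ≥ 0` for all `x`. -/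
def IsMVISolution (F : E → E) (g : E → EReal) (xs : E) : Prop :=
  xs ∈ dom g ∧ ∀ x, 0 ≤ ((inner ℝ (F xs) (x - xs) : ℝ) : EReal) + g x - g xs

/-- `p` minimizes `y ↦ w y + ‖x - y‖² / 2` over the whole space. -/
def IsProx (w : E → EReal) (x p : E) : Prop :=
  ∀ y, w p + ((‖x - p‖ ^ 2 / 2 : ℝ) : EReal) ≤ w y + ((‖x - y‖ ^ 2 / 2 : ℝ) : EReal)

/-- The proximal operator: the minimizer of `y ↦ w y + ‖x - y‖² / 2`
(it exists and is unique for proper lower semicontinuous convex `w`). -/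
def prox (w : E → EReal) (x : E) : E := Classical.epsilon (IsProx w x)

/-- `y(x) = prox_{lam g} (x - lam F x)`. -/
def proxStep (F : E → E) (g : E → EReal) (lam : ℝ) (x : E) : E :=
  prox (fun z => (lam : EReal) * g z) (x - lam • F x)

open Classical in
/-- The scaling factor `ρ` built from the operator `y`: zero on the fixed points of `y`. -/
def rho (κ₁ κ₂ α₁ α₂ : ℝ) (y : E → E) (x : E) : ℝ :=
  if y x = x then 0
  else κ₁ * (1 / ‖x - y x‖ ^ (1 - α₁)) + κ₂ * (1 / ‖x - y x‖ ^ (1 - α₂))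

/-- `x` is the forward-Euler sequence with time-step `η` started at `x₀`:
`x_{k+1} = x_k - η ρ(x_k) (x_k - y(x_k))`. -/
def IsEulerSolution (F : E → E) (g : E → EReal) (lam κ₁ κ₂ α₁ α₂ η : ℝ) (x₀ : E)
    (x : ℕ → E) : Prop :=
  x 0 = x₀ ∧ ∀ k, x (k + 1) = x k -
    (η * rho κ₁ κ₂ α₁ α₂ (proxStep F g lam) (x k)) • (x k - proxStep F g lam (x k))

/-- The step count `k* = ⌈ξ π / (2 η √(a b))⌉`. -/
def kStar (ξ a b η : ℝ) : ℕ := ⌈ξ * Real.pi / (2 * η * Real.sqrt (a * b))⌉₊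

end MVIP

end

open Filter Topology

namespace MVIP

/-! ### Proximal points of extended-real convex functions -/

section

variable {E : Type*} [NormedAddCommGroup E] [InnerProductSpace ℝ E]

/-! Solutions are the fixed points of `y = proxStep`. Since `F` is strongly monotone only on `dom
g`, `y` is known to contract, with factor `c < 1`, only on `K = closure (dom g)`, whereas the
iterates may leave `K`. The function `V x = ‖x - x*‖ + M * dist(x, K)` repairs this: for suitable
`M`, moving a fraction `s ≤ 1` of the way to `y x` multiplies `V` by at most `1 - (1 - c) s`
(`lyapunov_step_le`), and `‖x - y x‖` is comparable with `V x`.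

With `θ = 2 / ξ` the scheme thus gives `w' ≤ (1 - η (p w^(-θ) + q w^θ)) w` for `w = V x_k`, and each
step lowers `arctan (√(q/p) w^θ)` by at least `θ η √(pq)` (`arctan_step_le`). This angle starts
below `π/2` and cannot become negative, which yields both the tangent bound and `k*`. Near `x*` the
fraction `s` may exceed 1, but the displacement is `O(η)`; for small `η` the iterates never leave `V
< ε` again (`exists_step_forall_lt_or_arctan_le`). -/

lemma IsProperLscConvex.coe_toReal {g : E → EReal} (hg : IsProperLscConvex g) {x : E}
    (hx : x ∈ dom g) : ((g x).toReal : EReal) = g x :=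
  EReal.coe_toReal (ne_of_lt hx) (hg.ne_bot x)

lemma mem_dom_const_mul {g : E → EReal} (hg : IsProperLscConvex g) {lam : ℝ} (hlam : 0 < lam)
    {x : E} : x ∈ dom (fun z => (lam : EReal) * g z) ↔ x ∈ dom g := by
  simp only [dom, Set.mem_ofPred_eq]
  constructor
  · intro h
    by_contra h'
    rw [not_lt, top_le_iff] at h'
    rw [h', EReal.coe_mul_top_of_pos hlam] at h
    exact lt_irrefl _ h
  · intro h
    rw [← hg.coe_toReal h, ← EReal.coe_mul]
    exact EReal.coe_lt_top _

lemma IsProperLscConvex.const_mul {g : E → EReal} (hg : IsProperLscConvex g) {lam : ℝ}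
    (hlam : 0 < lam) : IsProperLscConvex (fun z => (lam : EReal) * g z) where
  ne_bot x := by
    by_cases hx : x ∈ dom g
    · rw [← hg.coe_toReal hx, ← EReal.coe_mul]
      exact EReal.coe_ne_bot _
    · have : g x = ⊤ := by simpa [dom] using hx
      simp [this, EReal.coe_mul_top_of_pos hlam]
  proper := hg.proper.imp fun x hx => (mem_dom_const_mul hg hlam).2 hx
  lsc := by
    rw [lowerSemicontinuous_iff_le_liminf]
    intro x
    rw [EReal.liminf_const_mul_of_nonneg_of_ne_top (by exact_mod_cast hlam.le)
      (EReal.coe_ne_top _)]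
    exact mul_le_mul_of_nonneg_left (lowerSemicontinuous_iff_le_liminf.1 hg.lsc x)
      (by exact_mod_cast hlam.le)
  convex x y s t hs ht hst := by
    have h0 : (0 : EReal) ≤ lam := by exact_mod_cast hlam.le
    have h := mul_le_mul_of_nonneg_left (hg.convex x y s t hs ht hst) h0
    rw [EReal.left_distrib_of_nonneg_of_ne_top h0 (EReal.coe_ne_top _)] at h
    rwa [mul_left_comm, mul_left_comm (lam : EReal)] at h

lemma convex_toReal {g : E → EReal} (hg : IsProperLscConvex g) {x y : E} (hx : x ∈ dom g)
    (hy : y ∈ dom g) {s t : ℝ} (hs : 0 ≤ s) (ht : 0 ≤ t) (hst : s + t = 1) :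
    s • x + t • y ∈ dom g ∧
      (g (s • x + t • y)).toReal ≤ s * (g x).toReal + t * (g y).toReal := by
  have h := hg.convex x y s t hs ht hst
  rw [← hg.coe_toReal hx, ← hg.coe_toReal hy, ← EReal.coe_mul, ← EReal.coe_mul,
    ← EReal.coe_add] at h
  have hd : s • x + t • y ∈ dom g := lt_of_le_of_lt h (EReal.coe_lt_top _)
  refine ⟨hd, ?_⟩
  rw [← hg.coe_toReal hd] at h
  exact_mod_cast h

lemma convex_dom {g : E → EReal} (hg : IsProperLscConvex g) : Convex ℝ (dom g) :=
  fun _ hx _ hy _ _ hs ht hst => (convex_toReal hg hx hy hs ht hst).1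

/-- A proper lower semicontinuous convex function decreases at most linearly. -/
lemma exists_linear_lower_bound [FiniteDimensional ℝ E] {g : E → EReal}
    (hg : IsProperLscConvex g) :
    ∃ x₁ ∈ dom g, ∃ A : ℝ, 0 ≤ A ∧ ∀ y ∈ dom g, -(A * (1 + ‖y - x₁‖)) ≤ (g y).toReal := by
  obtain ⟨x₁, hx₁⟩ := hg.proper
  obtain ⟨m, -, hm⟩ := LowerSemicontinuousOn.exists_isMinOn
    (s := Metric.closedBall x₁ 1) ⟨x₁, by simp⟩ (isCompact_closedBall x₁ 1)
    (hg.lsc.lowerSemicontinuousOn _)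
  have hmd : m ∈ dom g := by
    have h : g m ≤ g x₁ := hm (by simp : x₁ ∈ Metric.closedBall x₁ 1)
    exact h.trans_lt hx₁
  have hball : ∀ y ∈ dom g, ‖y - x₁‖ ≤ 1 → (g m).toReal ≤ (g y).toReal := by
    intro y hy hy1
    have h : g m ≤ g y := hm (by simpa [dist_eq_norm] using hy1)
    rw [← hg.coe_toReal hmd, ← hg.coe_toReal hy] at h
    exact_mod_cast h
  set c := (g m).toReal
  set d := (g x₁).toReal
  refine ⟨x₁, hx₁, |c| + |d|, by positivity, fun y hy => ?_⟩
  have hc := neg_abs_le c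
  have hd := neg_abs_le d
  have hd' := le_abs_self d
  have hR0 := norm_nonneg (y - x₁)
  rcases le_or_gt ‖y - x₁‖ 1 with h1 | h1
  · have := hball y hy h1
    nlinarith [abs_nonneg c, abs_nonneg d, mul_nonneg (abs_nonneg c) hR0,
      mul_nonneg (abs_nonneg d) hR0]
  · set R := ‖y - x₁‖
    have hR : 0 < R := by linarith
    have hinv : R⁻¹ ≤ 1 := inv_le_one_of_one_le₀ h1.le
    -- The segment from `x₁` to `y` meets the unit sphere around `x₁` here; the minimum over the
    -- ball and convexity bound `g y` below.
    obtain ⟨h2, h3⟩ := convex_toReal hg hx₁ hy (s := 1 - R⁻¹) (t := R⁻¹) (by linarith)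
      (by positivity) (by ring)
    have h4 : (1 - R⁻¹) • x₁ + R⁻¹ • y - x₁ = R⁻¹ • (y - x₁) := by module
    have h5 := hball _ h2 (by
      rw [h4, norm_smul, norm_inv, Real.norm_of_nonneg hR.le]
      exact (inv_mul_cancel₀ hR.ne').le)
    have h6 : R * c ≤ (R - 1) * d + (g y).toReal := by
      have := mul_le_mul_of_nonneg_left (h5.trans h3) hR.le
      calc R * c ≤ R * ((1 - R⁻¹) * d + R⁻¹ * (g y).toReal) := this
        _ = _ := by field_simp
    nlinarith [abs_nonneg c, abs_nonneg d]

lemma exists_isProx [FiniteDimensional ℝ E] {w : E → EReal} (hw : IsProperLscConvex w) (x : E) :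
    ∃ p, IsProx w x p := by
  obtain ⟨x₁, hx₁, A, hA, hlow⟩ := exists_linear_lower_bound hw
  set D := ‖x - x₁‖
  have hD : 0 ≤ D := norm_nonneg _
  set v := (w x₁).toReal
  -- Beyond this radius the quadratic term outweighs the linear lower bound, so a minimizer over the
  -- ball is global.
  set R := D + 2 * (A + |v| + D + D ^ 2) + 2
  have hlsc : LowerSemicontinuous fun y => w y + ((‖x - y‖ ^ 2 / 2 : ℝ) : EReal) := by
    have hc : Continuous fun y : E => ((‖x - y‖ ^ 2 / 2 : ℝ) : EReal) :=
      continuous_coe_real_ereal.comp (by fun_prop)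
    exact hw.lsc.add' hc.lowerSemicontinuous fun y =>
      EReal.continuousAt_add (.inr (EReal.coe_ne_bot _)) (.inr (EReal.coe_ne_top _))
  have hx₁R : x₁ ∈ Metric.closedBall x₁ R := by
    have : 0 ≤ R := by positivity
    simpa
  obtain ⟨p, -, hp⟩ := LowerSemicontinuousOn.exists_isMinOn
    (s := Metric.closedBall x₁ R) ⟨x₁, hx₁R⟩ (isCompact_closedBall x₁ R)
    (hlsc.lowerSemicontinuousOn _)
  refine ⟨p, fun y => ?_⟩
  by_cases hy : y ∈ Metric.closedBall x₁ R
  · exact hp hy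
  refine (hp hx₁R).trans ?_
  by_cases hyd : y ∈ dom w
  · change w x₁ + _ ≤ _
    rw [← hw.coe_toReal hx₁, ← hw.coe_toReal hyd, ← EReal.coe_add, ← EReal.coe_add,
      EReal.coe_le_coe_iff]
    have h1 := hlow y hyd
    have hyR : R < ‖y - x₁‖ := by simpa [dist_eq_norm] using hy
    have h2 : ‖y - x₁‖ - D ≤ ‖x - y‖ := by
      have := norm_sub_le_norm_sub_add_norm_sub y x x₁
      rw [norm_sub_rev y x] at this
      linarith
    set S := ‖y - x₁‖
    have hB : 0 ≤ A + |v| + D + D ^ 2 := by positivity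
    have h3 : (S - D) ^ 2 ≤ ‖x - y‖ ^ 2 :=
      pow_le_pow_left₀ (by linarith) h2 2
    have hv := le_abs_self v
    have hav := abs_nonneg v
    set u := S - D with hu
    have hS : S = u + D := by ring
    have hu1 : 2 * (A + |v| + D + D ^ 2) + 2 ≤ u := by linarith
    change v + D ^ 2 / 2 ≤ (w y).toReal + _
    have h4 : (2 * (A + |v| + D + D ^ 2) + 2) * u ≤ u * u :=
      mul_le_mul_of_nonneg_right hu1 (by linarith)
    rw [hS] at h1
    nlinarith [mul_nonneg hA hD, mul_nonneg hav (by linarith : 0 ≤ u - 2),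
      mul_nonneg (sq_nonneg D) (by linarith : 0 ≤ u - 2),
      mul_nonneg (by nlinarith : 0 ≤ u - A) (by linarith : 0 ≤ 1 + D)]
  · have : w y = ⊤ := by simpa [dom] using hyd
    rw [this, EReal.top_add_coe]
    exact le_top

lemma isProx_prox [FiniteDimensional ℝ E] {w : E → EReal} (hw : IsProperLscConvex w) (x : E) :
    IsProx w x (prox w x) :=
  Classical.epsilon_spec (exists_isProx hw x)

lemma IsProx.mem_dom {w : E → EReal} (hw : IsProperLscConvex w) {x p : E} (h : IsProx w x p) :
    p ∈ dom w := by
  obtain ⟨x₁, hx₁⟩ := hw.proper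
  have h1 := h x₁
  rw [← hw.coe_toReal hx₁, ← EReal.coe_add] at h1
  by_contra hp
  have : w p = ⊤ := by simpa [dom] using hp
  rw [this, EReal.top_add_coe] at h1
  exact absurd h1 (not_le.2 (EReal.coe_lt_top _))

/-- The variational inequality satisfied by a proximal point. -/
lemma IsProx.inner_le {w : E → EReal} (hw : IsProperLscConvex w) {x p : E} (h : IsProx w x p)
    {y : E} (hy : y ∈ dom w) :
    inner ℝ (x - p) (y - p) ≤ (w y).toReal - (w p).toReal := by
  have hp := h.mem_dom hw
  set e := y - p
  have key : ∀ t : ℝ, 0 < t → t ≤ 1 →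
      inner ℝ (x - p) e ≤ (w y).toReal - (w p).toReal + t * (‖e‖ ^ 2 / 2) := by
    intro t ht ht1
    obtain ⟨hd, hle⟩ := convex_toReal hw hp hy (s := 1 - t) (by linarith) ht.le (by ring)
    have h1 := h ((1 - t) • p + t • y)
    rw [← hw.coe_toReal hp, ← hw.coe_toReal hd, ← EReal.coe_add, ← EReal.coe_add,
      EReal.coe_le_coe_iff] at h1
    have h2 : x - ((1 - t) • p + t • y) = (x - p) - t • e := by
      simp only [e]; module
    rw [h2, norm_sub_sq_real (x - p), inner_smul_right, norm_smul, Real.norm_of_nonneg ht.le] at h1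
    have h3 : t * inner ℝ (x - p) e ≤
        t * ((w y).toReal - (w p).toReal + t * (‖e‖ ^ 2 / 2)) := by nlinarith
    exact le_of_mul_le_mul_left h3 ht
  have hlim : Tendsto (fun t : ℝ => (w y).toReal - (w p).toReal + t * (‖e‖ ^ 2 / 2)) (𝓝[>] 0)
      (𝓝 ((w y).toReal - (w p).toReal + 0 * (‖e‖ ^ 2 / 2))) :=
    tendsto_nhdsWithin_of_tendsto_nhds (Continuous.tendsto (by fun_prop) 0)
  rw [zero_mul, add_zero] at hlim
  refine ge_of_tendsto hlim ?_
  filter_upwards [Ioc_mem_nhdsGT (zero_lt_one' ℝ)] with t ht using key t ht.1 ht.2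

/-- Adding the variational inequalities at `p` and `p'` gives `‖p - p'‖² ≤ ⟨x - x', p - p'⟩`;
Cauchy–Schwarz finishes. -/
lemma IsProx.norm_sub_le {w : E → EReal} (hw : IsProperLscConvex w) {x x' p p' : E}
    (h : IsProx w x p) (h' : IsProx w x' p') : ‖p - p'‖ ≤ ‖x - x'‖ := by
  have h1 := h.inner_le hw (h'.mem_dom hw)
  have h2 := h'.inner_le hw (h.mem_dom hw)
  have h3 : inner ℝ (x - p) (p' - p) + inner ℝ (x' - p') (p - p') =
      ‖p - p'‖ ^ 2 - inner ℝ (x - x') (p - p') := by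
    rw [← real_inner_self_eq_norm_sq, ← neg_sub p p', inner_neg_right, ← sub_eq_neg_add,
      ← inner_sub_left, ← inner_sub_left]
    congr 1
    abel
  have h4 := real_inner_le_norm (x - x') (p - p')
  by_contra hcon
  rw [not_le] at hcon
  nlinarith [norm_nonneg (x - x'), norm_nonneg (p - p')]

lemma IsProx.unique {w : E → EReal} (hw : IsProperLscConvex w) {x p p' : E}
    (h : IsProx w x p) (h' : IsProx w x p') : p = p' := by
  simpa [sub_eq_zero] using h.norm_sub_le hw h'

end

/-! ### Solutions of the variational inequality as fixed points -/

section

variable {E : Type*} [NormedAddCommGroup E]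

lemma IsLipschitz.continuous {F : E → E} {L : ℝ} (hF : IsLipschitz F L) : Continuous F := by
  have : LipschitzWith L.toNNReal F := LipschitzWith.of_dist_le_mul fun x y => by
    rw [dist_eq_norm, dist_eq_norm, Real.coe_toNNReal L hF.1.le]
    exact hF.2 x y
  exact this.continuous

variable [InnerProductSpace ℝ E]

/-- Needed because nearest points exist in the closed set `closure (dom g)`, not necessarily in `dom
g`. -/
lemma StronglyMonotoneOn.closure {F : E → E} {S : Set E} {μ : ℝ}
    (h : StronglyMonotoneOn F S μ) (hF : Continuous F) :
    StronglyMonotoneOn F (_root_.closure S) μ := by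
  refine ⟨h.1, fun x hx y hy => ?_⟩
  have hcl : IsClosed {q : E × E | μ * ‖q.1 - q.2‖ ^ 2 ≤ inner ℝ (F q.1 - F q.2) (q.1 - q.2)} :=
    isClosed_le (by fun_prop) (by fun_prop)
  have hsub : _root_.closure (S ×ˢ S) ⊆
      {q : E × E | μ * ‖q.1 - q.2‖ ^ 2 ≤ inner ℝ (F q.1 - F q.2) (q.1 - q.2)} :=
    closure_minimal (fun q hq => h.2 q.1 (Set.mem_prod.1 hq).1 q.2 (Set.mem_prod.1 hq).2) hcl
  rw [closure_prod_eq] at hsub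
  exact hsub (Set.mk_mem_prod hx hy)

lemma StronglyMonotoneOn.forward_step_le {F : E → E} {S : Set E} {μ L lam : ℝ}
    (h : StronglyMonotoneOn F S μ) (hF : IsLipschitz F L) (hlam : 0 < lam) {x y : E}
    (hx : x ∈ S) (hy : y ∈ S) :
    ‖(x - lam • F x) - (y - lam • F y)‖ ^ 2 ≤
      (1 - 2 * lam * μ + lam ^ 2 * L ^ 2) * ‖x - y‖ ^ 2 := by
  have h1 : (x - lam • F x) - (y - lam • F y) = (x - y) - lam • (F x - F y) := by module
  rw [h1, norm_sub_sq_real (x - y), inner_smul_right, norm_smul, Real.norm_of_nonneg hlam.le,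
    real_inner_comm]
  have h2 := mul_le_mul_of_nonneg_left (h.2 x hx y hy) hlam.le
  have h3 := mul_le_mul_of_nonneg_left (pow_le_pow_left₀ (norm_nonneg _) (hF.2 x y) 2)
    (sq_nonneg lam)
  nlinarith

lemma IsLipschitz.forward_step_le {F : E → E} {L lam : ℝ} (hF : IsLipschitz F L)
    (hlam : 0 < lam) (x y : E) :
    ‖(x - lam • F x) - (y - lam • F y)‖ ≤ (1 + lam * L) * ‖x - y‖ := by
  have h1 : (x - lam • F x) - (y - lam • F y) = (x - y) - lam • (F x - F y) := by module
  have h2 := norm_sub_le (x - y) (lam • (F x - F y))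
  rw [norm_smul, Real.norm_of_nonneg hlam.le] at h2
  have h3 := mul_le_mul_of_nonneg_left (hF.2 x y) hlam.le
  rw [h1]
  linarith

/-- The inequality defining a solution, read in the reals on the effective domain. -/
lemma isMVISolution_iff {F : E → E} {g : E → EReal} (hg : IsProperLscConvex g) {xs : E} :
    IsMVISolution F g xs ↔ xs ∈ dom g ∧
      ∀ x ∈ dom g, 0 ≤ inner ℝ (F xs) (x - xs) + (g x).toReal - (g xs).toReal := by
  refine and_congr_right fun hxs => ⟨fun h x hx => ?_, fun h x => ?_⟩
  · have := h x
    rw [← hg.coe_toReal hxs, ← hg.coe_toReal hx, ← EReal.coe_add, ← EReal.coe_sub] at this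
    exact_mod_cast this
  · by_cases hx : x ∈ dom g
    · rw [← hg.coe_toReal hxs, ← hg.coe_toReal hx, ← EReal.coe_add, ← EReal.coe_sub]
      exact_mod_cast h x hx
    · have : g x = ⊤ := by simpa [dom] using hx
      rw [this, ← hg.coe_toReal hxs, EReal.coe_add_top, EReal.top_sub_coe]
      exact le_top

lemma IsMVISolution.unique {F : E → E} {g : E → EReal} {μ : ℝ} (hg : IsProperLscConvex g)
    (hmono : StronglyMonotoneOn F (dom g) μ) {x y : E} (hx : IsMVISolution F g x)
    (hy : IsMVISolution F g y) : x = y := by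
  rw [isMVISolution_iff hg] at hx hy
  have h1 := hx.2 y hy.1
  have h2 := hy.2 x hx.1
  have h3 := hmono.2 x hx.1 y hy.1
  rw [inner_sub_left] at h3
  rw [← neg_sub x y, inner_neg_right] at h1
  have h4 : μ * ‖x - y‖ ^ 2 ≤ 0 := by linarith
  have h5 : ‖x - y‖ ^ 2 ≤ 0 := nonpos_of_mul_nonpos_right h4 hmono.1
  have h6 : ‖x - y‖ = 0 := by nlinarith [norm_nonneg (x - y)]
  exact sub_eq_zero.1 (norm_eq_zero.1 h6)

section proxStep

variable [FiniteDimensional ℝ E] {F : E → E} {g : E → EReal} {lam : ℝ}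

lemma isProx_proxStep (hg : IsProperLscConvex g) (hlam : 0 < lam) (x : E) :
    IsProx (fun z => (lam : EReal) * g z) (x - lam • F x) (proxStep F g lam x) :=
  isProx_prox (hg.const_mul hlam) _

lemma proxStep_mem_dom (hg : IsProperLscConvex g) (hlam : 0 < lam) (x : E) :
    proxStep F g lam x ∈ dom g :=
  (mem_dom_const_mul hg hlam).1 ((isProx_proxStep hg hlam x).mem_dom (hg.const_mul hlam))

lemma norm_proxStep_sub_le (hg : IsProperLscConvex g) (hlam : 0 < lam) (x y : E) :
    ‖proxStep F g lam x - proxStep F g lam y‖ ≤ ‖(x - lam • F x) - (y - lam • F y)‖ :=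
  (isProx_proxStep hg hlam x).norm_sub_le (hg.const_mul hlam) (isProx_proxStep hg hlam y)

/-- Solutions of the mixed variational inequality are the fixed points of the proximal step. -/
lemma isMVISolution_iff_proxStep_eq (hg : IsProperLscConvex g) (hlam : 0 < lam) (x : E) :
    IsMVISolution F g x ↔ proxStep F g lam x = x := by
  constructor
  · intro h
    rw [isMVISolution_iff hg] at h
    refine (isProx_proxStep hg hlam x).unique (hg.const_mul hlam) fun y => ?_
    by_cases hy : y ∈ dom g
    · dsimp only
      rw [← hg.coe_toReal h.1, ← hg.coe_toReal hy, ← EReal.coe_mul, ← EReal.coe_mul,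
        ← EReal.coe_add, ← EReal.coe_add, EReal.coe_le_coe_iff]
      have h1 : x - lam • F x - x = -(lam • F x) := by abel
      have h2 : x - lam • F x - y = -((y - x) + lam • F x) := by abel
      rw [h1, h2, norm_neg, norm_neg, norm_add_sq_real (y - x), inner_smul_right,
        real_inner_comm]
      have h3 := mul_nonneg hlam.le (h.2 y hy)
      nlinarith [sq_nonneg ‖y - x‖]
    · have : g y = ⊤ := by simpa [dom] using hy
      dsimp only
      rw [this, EReal.coe_mul_top_of_pos hlam, EReal.top_add_coe]
      exact le_top
  · intro h
    have hw := hg.const_mul hlam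
    have hp := isProx_proxStep (F := F) hg hlam x
    rw [h] at hp
    rw [isMVISolution_iff hg]
    refine ⟨h ▸ proxStep_mem_dom hg hlam x, fun y hy => ?_⟩
    have h1 := hp.inner_le hw ((mem_dom_const_mul hg hlam).2 hy)
    have h2 : x - lam • F x - x = -(lam • F x) := by abel
    rw [h2, inner_neg_left, real_inner_smul_left, EReal.toReal_mul, EReal.toReal_mul,
      EReal.toReal_coe] at h1
    have h3 : 0 ≤ lam * (inner ℝ (F x) (y - x) + (g y).toReal - (g x).toReal) := by linarith
    exact nonneg_of_mul_nonneg_right h3 hlam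

/-- The proximal step contracts the closure of the effective domain. -/
lemma exists_contraction_proxStep {μ L : ℝ} (hg : IsProperLscConvex g)
    (hmono : StronglyMonotoneOn F (dom g) μ) (hlip : IsLipschitz F L) (hlam : 0 < lam)
    (hlam' : lam < 2 * μ / L ^ 2) :
    ∃ c : ℝ, 0 < c ∧ c < 1 ∧ ∀ x ∈ closure (dom g), ∀ y ∈ closure (dom g),
      ‖proxStep F g lam x - proxStep F g lam y‖ ≤ c * ‖x - y‖ := by
  set q := 1 - 2 * lam * μ + lam ^ 2 * L ^ 2 with hq
  have hq1 : q < 1 := by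
    rw [lt_div_iff₀ (pow_pos hlip.1 2)] at hlam'
    nlinarith
  -- The maximum keeps `c` positive, as the later division `A / c` requires; `q` itself may be
  -- nonpositive when `dom g` is a single point.
  refine ⟨√(max q (1 / 2)), Real.sqrt_pos.2 (by positivity), ?_, fun x hx y hy => ?_⟩
  · rw [Real.sqrt_lt' one_pos, one_pow]
    exact max_lt hq1 (by norm_num)
  · have h := (hmono.closure hlip.continuous).forward_step_le hlip hlam hx hy
    refine (norm_proxStep_sub_le hg hlam x y).trans (abs_le_of_sq_le_sq' ?_ (by positivity) |>.2)
    rw [mul_pow, Real.sq_sqrt (by positivity)]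
    exact h.trans (mul_le_mul_of_nonneg_right (le_max_left _ _) (sq_nonneg _))

/-- Banach's theorem on the complete set `closure (dom g)`, at the midpoint of the admissible step
lengths. Being a solution does not depend on that choice. -/
lemma exists_isMVISolution {μ L : ℝ} (hg : IsProperLscConvex g)
    (hmono : StronglyMonotoneOn F (dom g) μ) (hlip : IsLipschitz F L) :
    ∃ xs, IsMVISolution F g xs := by
  have hL := hlip.1
  have hμ := hmono.1
  have hlam : 0 < μ / L ^ 2 := by positivity
  obtain ⟨c, hc0, hc1, hc⟩ := exists_contraction_proxStep hg hmono hlip hlam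
    (by gcongr; linarith)
  have hmaps : Set.MapsTo (proxStep F g (μ / L ^ 2)) (closure (dom g)) (closure (dom g)) :=
    fun x _ => subset_closure (proxStep_mem_dom hg hlam x)
  have hcontr : ContractingWith c.toNNReal (hmaps.restrict _ _ _) := by
    refine ⟨Real.toNNReal_lt_one.2 hc1, LipschitzWith.of_dist_le_mul fun x y => ?_⟩
    rw [Subtype.dist_eq, Subtype.dist_eq, dist_eq_norm, dist_eq_norm, Real.coe_toNNReal c hc0.le]
    exact hc x x.2 y y.2
  obtain ⟨x₁, hx₁⟩ := hg.proper
  obtain ⟨xs, -, hfix, -⟩ := hcontr.exists_fixedPoint' isClosed_closure.isComplete hmaps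
    (subset_closure hx₁) (edist_ne_top _ _)
  exact ⟨xs, (isMVISolution_iff_proxStep_eq hg hlam xs).2 hfix⟩

end proxStep

end

/-! ### The scalar recursion and its arctangent potential -/

lemma arctan_le_add_div {v w : ℝ} (hv : 0 ≤ v) (hw : 0 ≤ w) (hwv : w ≤ v) :
    Real.arctan w ≤ Real.arctan v - (v - w) / (1 + v ^ 2) := by
  rcases hwv.eq_or_lt with rfl | hlt
  · simp
  obtain ⟨z, hz, hder⟩ := exists_hasDerivAt_eq_slope Real.arctan (fun x => 1 / (1 + x ^ 2)) hlt
    Real.continuous_arctan.continuousOn fun x _ => Real.hasDerivAt_arctan x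
  have h1 : 0 < v - w := sub_pos.2 hlt
  rw [eq_div_iff h1.ne'] at hder
  -- On `[w, v]` the slope of arctan is least at the right end.
  have h2 : 1 / (1 + v ^ 2) ≤ 1 / (1 + z ^ 2) := by
    have := hz.1
    have := hz.2
    gcongr
    linarith
  have h3 : (v - w) / (1 + v ^ 2) ≤ 1 / (1 + z ^ 2) * (v - w) := by
    rw [div_eq_mul_one_div, mul_comm]
    exact mul_le_mul_of_nonneg_right h2 h1.le
  linarith

/-- One explicit Euler step for `w' = -(p w ^ (1 - θ) + q w ^ (1 + θ))` decreases
`arctan (√(q / p) w ^ θ)` by at least `θ √(p q)` times the step size. -/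
lemma arctan_step_le {p q θ η w w' : ℝ} (hp : 0 < p) (hq : 0 < q) (hθ : 0 < θ) (hθ1 : θ ≤ 1)
    (hη : 0 ≤ η) (hw : 0 < w) (hw' : 0 < w')
    (hstep : w' ≤ (1 - η * (p / w ^ θ + q * w ^ θ)) * w) :
    Real.arctan (√(q / p) * w' ^ θ) ≤ Real.arctan (√(q / p) * w ^ θ) - θ * η * √(p * q) := by
  set u := w ^ θ with hu
  have hu0 : 0 < u := Real.rpow_pos_of_pos hw θ
  set z := η * (p / u + q * u)
  have hz0 : 0 ≤ z := by positivity
  have hz1 : 0 < 1 - z := pos_of_mul_pos_left (hw'.trans_le hstep) hw.le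
  -- Bernoulli's inequality for the exponent `θ ≤ 1`.
  have h1 : w' ^ θ ≤ (1 - θ * z) * u := by
    calc w' ^ θ ≤ ((1 - z) * w) ^ θ := Real.rpow_le_rpow hw'.le hstep hθ.le
      _ = (1 + -z) ^ θ * u := by rw [Real.mul_rpow hz1.le hw.le, sub_eq_add_neg]
      _ ≤ (1 + θ * -z) * u := by
        gcongr
        exact rpow_one_add_le_one_add_mul_self (by linarith) hθ.le hθ1
      _ = _ := by ring
  set s := √(q / p) with hs
  have hs0 : 0 < s := Real.sqrt_pos.2 (by positivity)
  have hs2 : s ^ 2 = q / p := Real.sq_sqrt (by positivity)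
  have hpq : √(p * q) = p * s := by
    rw [hs, ← Real.sqrt_sq hp.le, ← Real.sqrt_mul (by positivity), Real.sqrt_sq hp.le]
    congr 1
    field_simp
  -- Since `p + q u² = p (1 + (s u)²)`, the decrement carries exactly the factor that the slope of
  -- arctan cancels.
  have h2 : s * w' ^ θ ≤ s * u - θ * η * √(p * q) * (1 + (s * u) ^ 2) := by
    calc s * w' ^ θ ≤ s * ((1 - θ * z) * u) := by gcongr
      _ = _ := by
        simp only [z]
        rw [hpq, mul_pow, hs2]
        field_simp
  have hd : 0 ≤ θ * η * √(p * q) * (1 + (s * u) ^ 2) := by positivity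
  have h3 := arctan_le_add_div (v := s * u) (w := s * w' ^ θ) (by positivity) (by positivity)
    (by linarith)
  have h4 : θ * η * √(p * q) ≤ (s * u - s * w' ^ θ) / (1 + (s * u) ^ 2) := by
    rw [le_div_iff₀ (by positivity)]
    linarith
  linarith

/-- Fixed-time convergence, up to `ε`, of a discrete Lyapunov sequence `W` along a scheme with
scaling factor `ρ` and residual `r` comparable with `W`. -/
lemma exists_step_forall_lt_or_arctan_le {κ₁ κ₂ θ c m B : ℝ} (hκ₁ : 0 < κ₁) (hκ₂ : 0 < κ₂)
    (hθ : 0 < θ) (hθ1 : θ ≤ 1) (hc1 : c < 1) (hm : 0 < m) (hB : 0 ≤ B) (W₀ : ℝ) {ε : ℝ}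
    (hε : 0 < ε) :
    ∃ ηs : ℝ, 0 < ηs ∧ ∀ η : ℝ, 0 < η → η ≤ ηs → ∀ W r ρ : ℕ → ℝ, W 0 = W₀ →
      (∀ k, 0 ≤ r k) → (∀ k, m * W k ≤ r k) → (∀ k, r k ≤ 2 * W k) →
      (∀ k, r k = 0 → ρ k = 0) →
      (∀ k, 0 < r k → ρ k = κ₁ * (1 / r k ^ θ) + κ₂ * (1 / r k ^ (-θ))) →
      (∀ k, 0 ≤ η * ρ k → η * ρ k ≤ 1 → W (k + 1) ≤ (1 - (1 - c) * (η * ρ k)) * W k) →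
      (∀ k, 0 ≤ η * ρ k → W (k + 1) ≤ W k + B * (η * ρ k * r k)) →
      ∀ k, W k < ε ∨ Real.arctan (√(((1 - c) * κ₂ * m ^ θ) / ((1 - c) * κ₁ / 2 ^ θ)) * W k ^ θ) <
        Real.pi / 2 - θ * η * √((1 - c) * κ₁ / 2 ^ θ * ((1 - c) * κ₂ * m ^ θ)) * k := by
  set p := (1 - c) * κ₁ / 2 ^ θ with hp
  set q := (1 - c) * κ₂ * m ^ θ with hq
  have hc : 0 < 1 - c := sub_pos.2 hc1
  have hp0 : 0 < p := by positivity
  have hq0 : 0 < q := by positivity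
  set R := max W₀ ε
  have hR : 0 < R := lt_max_of_lt_right hε
  set δ := ε / 2 with hδ
  have hδ0 : 0 < δ := by positivity
  -- `S` bounds `ρ` while `δ ≤ W ≤ R`; `T` bounds `B ρ r` while `W < δ`, where `ρ` alone may blow
  -- up.
  set S := κ₁ / (m * δ) ^ θ + κ₂ * (2 * R) ^ θ
  have hS : 0 < S := by positivity
  set T := B * (κ₁ * (2 * δ) ^ (1 - θ) + κ₂ * (2 * δ) ^ (1 + θ))
  have hT : 0 ≤ T := by positivity
  refine ⟨min (1 / S) (δ / (T + 1)), by positivity, ?_⟩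
  intro η hη hηs W r ρ hW0 hr hmr hr2 hρ0 hρ hcontr hjump
  have hηS : η * S ≤ 1 := by
    have := hηs.trans (min_le_left _ _)
    rwa [le_div_iff₀ hS] at this
  have hηT : η * T < δ := by
    have := hηs.trans (min_le_right _ _)
    rw [le_div_iff₀ (by positivity)] at this
    linarith
  have hρnn : ∀ k, 0 ≤ ρ k := by
    intro k
    rcases (hr k).eq_or_lt with h | h
    · exact (hρ0 k h.symm).ge
    · rw [hρ k h]; positivity
  have hsnn : ∀ k, 0 ≤ η * ρ k := fun k => mul_nonneg hη.le (hρnn k)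
  have hρ' : ∀ k, 0 < r k → ρ k = κ₁ / r k ^ θ + κ₂ * r k ^ θ := by
    intro k hk
    rw [hρ k hk, Real.rpow_neg hk.le, one_div, one_div, inv_inv, div_eq_mul_inv]
  have hlarge : ∀ k, δ ≤ W k → W k ≤ R →
      W (k + 1) ≤ (1 - η * (p / W k ^ θ + q * W k ^ θ)) * W k := by
    intro k hk1 hk2
    have hWk : 0 < W k := hδ0.trans_le hk1
    have hrk : 0 < r k := (mul_pos hm hWk).trans_le (hmr k)
    have hle : η * ρ k ≤ 1 := by
      refine le_trans ?_ hηS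
      rw [hρ' k hrk]
      have h1 : m * δ ≤ r k := (mul_le_mul_of_nonneg_left hk1 hm.le).trans (hmr k)
      have h2 : r k ≤ 2 * R := (hr2 k).trans (by linarith)
      simp only [S]
      gcongr
    refine (hcontr k (hsnn k) hle).trans ?_
    have h3 : p / W k ^ θ + q * W k ^ θ ≤ (1 - c) * ρ k := by
      have e1 : p / W k ^ θ = (1 - c) * (κ₁ / (2 * W k) ^ θ) := by
        rw [Real.mul_rpow (by norm_num) hWk.le, hp]
        field_simp
      have e2 : q * W k ^ θ = (1 - c) * (κ₂ * (m * W k) ^ θ) := by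
        rw [Real.mul_rpow hm.le hWk.le, hq]
        ring
      have h4 := hr2 k
      have h5 := hmr k
      rw [hρ' k hrk, e1, e2, ← mul_add]
      gcongr
    have h4 := mul_le_mul_of_nonneg_left h3 hη.le
    exact mul_le_mul_of_nonneg_right (by linarith) hWk.le
  have hsmall : ∀ k, W k < ε → W (k + 1) < ε := by
    intro k hk
    rcases le_or_gt δ (W k) with h | h
    · have hWk : 0 < W k := hδ0.trans_le h
      have h1 := hlarge k h (hk.le.trans (le_max_right _ _))
      have h2 : 0 ≤ η * (p / W k ^ θ + q * W k ^ θ) * W k := by positivity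
      linarith
    · have h1 : ρ k * r k ≤ κ₁ * (2 * δ) ^ (1 - θ) + κ₂ * (2 * δ) ^ (1 + θ) := by
        rcases (hr k).eq_or_lt with h0 | h0
        · rw [← h0, mul_zero]
          positivity
        · have h2 : r k ≤ 2 * δ := by linarith [hr2 k]
          have e : ρ k * r k = κ₁ * r k ^ (1 - θ) + κ₂ * r k ^ (1 + θ) := by
            rw [hρ' k h0, Real.rpow_sub h0, Real.rpow_add h0, Real.rpow_one]
            ring
          rw [e]
          have : 0 ≤ 1 - θ := by linarith
          gcongr
      have h2 : B * (η * ρ k * r k) ≤ η * T := by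
        have := mul_le_mul_of_nonneg_left h1 (mul_nonneg hη.le hB)
        simp only [T]
        linarith
      have := hjump k (hsnn k)
      linarith
  -- The bound `W k ≤ R` is carried through the induction so that `hlarge` stays applicable.
  have key : ∀ k, W k < ε ∨ (ε ≤ W k ∧ W k ≤ R ∧
      Real.arctan (√(q / p) * W k ^ θ) < Real.pi / 2 - θ * η * √(p * q) * k) := by
    intro k
    induction k with
    | zero =>
      rcases lt_or_ge (W 0) ε with h | h
      · exact .inl h
      · refine .inr ⟨h, hW0 ▸ le_max_left _ _, ?_⟩
        simpa using Real.arctan_lt_pi_div_two _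
    | succ k ih =>
      rcases lt_or_ge (W (k + 1)) ε with h | h
      · exact .inl h
      rcases ih with h' | ⟨h1, h2, h3⟩
      · exact .inl (hsmall k h')
      · have hWk : 0 < W k := hε.trans_le h1
        have h4 := hlarge k (by linarith) h2
        have h5 : 0 ≤ η * (p / W k ^ θ + q * W k ^ θ) * W k := by positivity
        have h6 := arctan_step_le hp0 hq0 hθ hθ1 hη.le hWk (hε.trans_le h) h4
        refine .inr ⟨h, by linarith, ?_⟩
        push_cast
        linarith
  exact fun k => (key k).imp_right fun h => h.2.2

/-! ### The Lyapunov function -/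

section

variable {E : Type*} [NormedAddCommGroup E]

/-- Distance to `xs` plus a multiple of the distance to `K`. -/
noncomputable def lyapunov (xs : E) (K : Set E) (M : ℝ) (x : E) : ℝ := ‖x - xs‖ + M * Metric.infDist x K

section Lyapunov

variable {xs : E} {K : Set E} {A c M : ℝ}

lemma norm_sub_le_lyapunov (hM : 0 ≤ M) (x : E) : ‖x - xs‖ ≤ lyapunov xs K M x :=
  le_add_of_nonneg_right (mul_nonneg hM Metric.infDist_nonneg)

/-- Controls steps near the solution, where the fraction may exceed 1 and the contraction estimate
is unavailable. -/
lemma lyapunov_sub_le (hM : 0 ≤ M) (x v : E) :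
    lyapunov xs K M (x - v) ≤ lyapunov xs K M x + (1 + M) * ‖v‖ := by
  have h1 : ‖x - v - xs‖ ≤ ‖x - xs‖ + ‖v‖ := by
    rw [sub_right_comm]
    exact norm_sub_le _ _
  have h2 : Metric.infDist (x - v) K ≤ Metric.infDist x K + ‖v‖ := by
    refine (Metric.infDist_le_infDist_add_dist (y := x)).trans_eq ?_
    rw [dist_eq_norm, sub_sub_cancel_left, norm_neg]
  have h3 := mul_le_mul_of_nonneg_left h2 hM
  unfold lyapunov
  linarith

lemma norm_sub_le_two_mul_lyapunov {x y : E} (hc1 : c ≤ 1) (hA : A ≤ M) (hM : 0 ≤ M)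
    (hxy : ‖y - xs‖ ≤ c * ‖x - xs‖ + A * Metric.infDist x K) :
    ‖x - y‖ ≤ 2 * lyapunov xs K M x := by
  have h1 : ‖x - y‖ ≤ ‖x - xs‖ + ‖y - xs‖ := by
    rw [norm_sub_rev y xs]
    exact norm_sub_le_norm_sub_add_norm_sub _ _ _
  have hd : 0 ≤ Metric.infDist x K := Metric.infDist_nonneg
  have h2 := mul_le_mul_of_nonneg_right hA hd
  have h3 := mul_le_mul_of_nonneg_right hc1 (norm_nonneg (x - xs))
  have h4 := mul_nonneg hM hd
  unfold lyapunov
  linarith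

/-- As `y ∈ K`, the residual dominates the distance to `K`; the term `c * ‖x - xs‖` is absorbed on
the left. -/
lemma lyapunov_le_mul_norm_sub {x y : E} (hy : y ∈ K) (hc1 : c < 1) (hA : 0 ≤ A) (hM : 0 ≤ M)
    (hxy : ‖y - xs‖ ≤ c * ‖x - xs‖ + A * Metric.infDist x K) :
    lyapunov xs K M x ≤ ((1 + A) / (1 - c) + M) * ‖x - y‖ := by
  have hd : Metric.infDist x K ≤ ‖x - y‖ :=
    dist_eq_norm x y ▸ Metric.infDist_le_dist_of_mem hy
  have h1 : ‖x - xs‖ ≤ ‖x - y‖ + ‖y - xs‖ := norm_sub_le_norm_sub_add_norm_sub _ _ _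
  have h2 := mul_le_mul_of_nonneg_left hd hA
  have h3 : ‖x - xs‖ ≤ (1 + A) / (1 - c) * ‖x - y‖ := by
    rw [div_mul_eq_mul_div, le_div_iff₀ (by linarith)]
    linarith
  have h4 := mul_le_mul_of_nonneg_left hd hM
  unfold lyapunov
  linarith

variable [InnerProductSpace ℝ E]

/-- A step from `x` towards a point `y` of the convex set `K`. -/
lemma infDist_step_le [FiniteDimensional ℝ E] (hK : IsClosed K) (hconv : Convex ℝ K) {x y : E}
    (hy : y ∈ K) {s : ℝ} (hs0 : 0 ≤ s) (hs1 : s ≤ 1) :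
    Metric.infDist (x - s • (x - y)) K ≤ (1 - s) * Metric.infDist x K := by
  obtain ⟨P, hP, hdist⟩ := hK.exists_infDist_eq_dist ⟨y, hy⟩ x
  have hmem : (1 - s) • P + s • y ∈ K := hconv hP hy (by linarith) hs0 (by ring)
  refine (Metric.infDist_le_dist_of_mem hmem).trans_eq ?_
  rw [hdist, dist_eq_norm, dist_eq_norm]
  have h : x - s • (x - y) - ((1 - s) • P + s • y) = (1 - s) • (x - P) := by module
  rw [h, norm_smul, Real.norm_of_nonneg (by linarith)]

/-- The norm term gains the error `s A d`, with `d` the distance to `K`, while the distance term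
loses `s M d`. With `A = c M` the net loss is `(1 - c) s M d`, the same rate as for the norm. -/
lemma lyapunov_step_le [FiniteDimensional ℝ E] (hK : IsClosed K) (hconv : Convex ℝ K) {x y : E}
    (hy : y ∈ K) (hM : 0 ≤ M) (hcM : A = c * M)
    (hxy : ‖y - xs‖ ≤ c * ‖x - xs‖ + A * Metric.infDist x K) {s : ℝ} (hs0 : 0 ≤ s)
    (hs1 : s ≤ 1) :
    lyapunov xs K M (x - s • (x - y)) ≤ (1 - (1 - c) * s) * lyapunov xs K M x := by
  have h1 : ‖x - s • (x - y) - xs‖ ≤ (1 - s) * ‖x - xs‖ + s * ‖y - xs‖ := by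
    have h : x - s • (x - y) - xs = (1 - s) • (x - xs) + s • (y - xs) := by module
    rw [h]
    refine (norm_add_le _ _).trans_eq ?_
    rw [norm_smul, norm_smul, Real.norm_of_nonneg (by linarith), Real.norm_of_nonneg hs0]
  have h2 := mul_le_mul_of_nonneg_left (infDist_step_le hK hconv (x := x) hy hs0 hs1) hM
  have h3 := mul_le_mul_of_nonneg_left hxy hs0
  unfold lyapunov
  rw [hcM] at h3
  nlinarith

end Lyapunov

/-! ### Fixed-time bound for the Euler scheme -/

variable [InnerProductSpace ℝ E]

/-- Off the closed effective domain the proximal step is a contraction towards the solution up to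
a multiple of the distance to the domain. -/
lemma norm_proxStep_sub_solution_le [FiniteDimensional ℝ E] {F : E → E} {g : E → EReal}
    {L lam c : ℝ} (hg : IsProperLscConvex g) (hlip : IsLipschitz F L) (hlam : 0 < lam)
    (hc0 : 0 ≤ c) (hc1 : c ≤ 1)
    (hc : ∀ x ∈ closure (dom g), ∀ y ∈ closure (dom g),
      ‖proxStep F g lam x - proxStep F g lam y‖ ≤ c * ‖x - y‖)
    {xs : E} (hxs : IsMVISolution F g xs) (x : E) :
    ‖proxStep F g lam x - xs‖ ≤
      c * ‖x - xs‖ + (2 + lam * L) * Metric.infDist x (closure (dom g)) := by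
  -- Pass through the nearest point `P`: Lipschitz from `x` to `P` (factor `1 + lam * L`),
  -- contraction from `P` to `xs`; returning from `P` to `x` costs at most one more distance.
  obtain ⟨P, hP, hdist⟩ :=
    isClosed_closure.exists_infDist_eq_dist hg.proper.closure x
  rw [hdist, dist_eq_norm]
  have hfix := (isMVISolution_iff_proxStep_eq hg hlam xs).1 hxs
  have h1 := hc P hP xs (subset_closure hxs.1)
  rw [hfix] at h1
  have h2 := (norm_proxStep_sub_le (F := F) hg hlam x P).trans (hlip.forward_step_le hlam x P)
  have h3 := norm_sub_le_norm_sub_add_norm_sub (proxStep F g lam x) (proxStep F g lam P) xs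
  have h4 := norm_sub_le_norm_sub_add_norm_sub P x xs
  rw [norm_sub_rev P x] at h4
  have h5 := mul_le_mul_of_nonneg_left h4 hc0
  have h6 := mul_le_mul_of_nonneg_right hc1 (norm_nonneg (x - P))
  linarith

lemma lt_tan_rpow_of_arctan_lt {s w θ φ : ℝ} (hs : 0 < s) (hw : 0 ≤ w) (hθ : 0 < θ)
    (hφ : φ < Real.pi / 2) (h : Real.arctan (s * w ^ θ) < φ) :
    w < (s⁻¹ * Real.tan φ) ^ θ⁻¹ := by
  have h1 : s * w ^ θ < Real.tan φ := by
    rw [← Real.tan_arctan (s * w ^ θ)]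
    exact Real.tan_lt_tan_of_lt_of_lt_pi_div_two (Real.neg_pi_div_two_lt_arctan _) hφ h
  have h2 : w ^ θ < s⁻¹ * Real.tan φ := by
    rwa [lt_inv_mul_iff₀ hs]
  calc w = (w ^ θ) ^ θ⁻¹ := (Real.rpow_rpow_inv hw hθ.ne').symm
    _ < _ := Real.rpow_lt_rpow (by positivity) h2 (inv_pos.2 hθ)

/-- Fixed-time convergence of the forward-Euler scheme, for every exponent parameter `ξ > 2`. -/
theorem exists_fixedTime_bound [FiniteDimensional ℝ E] {F : E → E} {g : E → EReal}
    {μ L κ₁ κ₂ lam ξ : ℝ} (hg : IsProperLscConvex g) (hmono : StronglyMonotoneOn F (dom g) μ)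
    (hlip : IsLipschitz F L) (hκ₁ : 0 < κ₁) (hκ₂ : 0 < κ₂) (hlam : 0 < lam)
    (hlam' : lam < 2 * μ / L ^ 2) (hξ : 2 < ξ) {xs : E} (hxs : IsMVISolution F g xs) :
    ∃ a b : ℝ, 0 < a ∧ 0 < b ∧ ∀ (x₀ : E) (ε : ℝ), 0 < ε →
      ∃ ηs : ℝ, 0 < ηs ∧ ∀ η : ℝ, 0 < η → η ≤ ηs → ∀ x : ℕ → E,
        IsEulerSolution F g lam κ₁ κ₂ (1 - 2 / ξ) (1 + 2 / ξ) η x₀ x → ∀ k : ℕ,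
          (0 < k → k < kStar ξ a b η → ‖x k - xs‖ <
            (√(a / b) * Real.tan (Real.pi / 2 - √(a * b) / ξ * η * k)) ^ (ξ / 2) + ε) ∧
          (kStar ξ a b η ≤ k → ‖x k - xs‖ < ε) := by
  obtain ⟨c, hc0, hc1, hc⟩ := exists_contraction_proxStep hg hmono hlip hlam hlam'
  have hL := hlip.1
  set K := closure (dom g)
  set A := 2 + lam * L with hA
  have hA0 : 0 < A := by positivity
  set M := A / c with hM
  have hM0 : 0 < M := by positivity
  have hAcM : A = c * M := by rw [hM]; field_simp
  have hAM : A ≤ M := by rw [hM]; exact le_div_self hA0.le hc0 hc1.le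
  have hc' : 0 < 1 - c := sub_pos.2 hc1
  set D := (1 + A) / (1 - c) + M
  have hD : 0 < D := by positivity
  set m := D⁻¹
  have hm : 0 < m := inv_pos.2 hD
  have hK : IsClosed K := isClosed_closure
  have hconv : Convex ℝ K := (convex_dom hg).closure
  have hyK : ∀ x, proxStep F g lam x ∈ K := fun x => subset_closure (proxStep_mem_dom hg hlam x)
  have hy : ∀ x, ‖proxStep F g lam x - xs‖ ≤ c * ‖x - xs‖ + A * Metric.infDist x K :=
    norm_proxStep_sub_solution_le hg hlip hlam hc0.le hc1.le hc hxs
  have hξ0 : 0 < ξ := by linarith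
  set θ := 2 / ξ with hθdef
  have hθ : 0 < θ := by positivity
  have hθ1 : θ ≤ 1 := by rw [hθdef, div_le_one hξ0]; exact hξ.le
  set p := (1 - c) * κ₁ / 2 ^ θ
  set q := (1 - c) * κ₂ * m ^ θ
  have hp : 0 < p := by positivity
  have hq : 0 < q := by positivity
  -- The factor 2 turns `√(ab) / ξ` into `θ √(pq)` and leaves `a / b = p / q`.
  refine ⟨2 * p, 2 * q, by positivity, by positivity, fun x₀ ε hε => ?_⟩
  obtain ⟨ηs, hηs, H⟩ := exists_step_forall_lt_or_arctan_le hκ₁ hκ₂ hθ hθ1 hc1 hm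
    (by positivity : 0 ≤ 1 + M) (lyapunov xs K M x₀) hε
  refine ⟨ηs, hηs, fun η hη hηle x hx k => ?_⟩
  set W := fun k => lyapunov xs K M (x k) with hW
  set y := proxStep F g lam
  have hstep : ∀ k, x (k + 1) =
      x k - (η * rho κ₁ κ₂ (1 - θ) (1 + θ) y (x k)) • (x k - y (x k)) := hx.2
  have hWk := H η hη hηle W (fun k => ‖x k - y (x k)‖)
    (fun k => rho κ₁ κ₂ (1 - θ) (1 + θ) y (x k)) (by simp only [hW, hx.1])
    (fun k => norm_nonneg _)
    (fun k => by
      rw [inv_mul_le_iff₀ hD]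
      exact lyapunov_le_mul_norm_sub (hyK _) hc1 hA0.le hM0.le (hy _))
    (fun k => norm_sub_le_two_mul_lyapunov hc1.le hAM hM0.le (hy _))
    (fun k h => if_pos (sub_eq_zero.1 (norm_eq_zero.1 h)).symm)
    (fun k h => by
      have : y (x k) ≠ x k := fun h' => by simp [h'] at h
      rw [rho, if_neg this, sub_sub_cancel, sub_add_cancel_left])
    (fun k h0 h1 => by
      simp only [hW, hstep k]
      exact lyapunov_step_le hK hconv (hyK _) hM0.le hAcM (hy _) h0 h1)
    (fun k h0 => by
      simp only [hW, hstep k]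
      refine (lyapunov_sub_le hM0.le _ _).trans_eq ?_
      rw [norm_smul, Real.norm_of_nonneg h0])
    k
  change W k < ε ∨ Real.arctan (√(q / p) * W k ^ θ) <
    Real.pi / 2 - θ * η * √(p * q) * k at hWk
  have hnorm : ‖x k - xs‖ ≤ W k := norm_sub_le_lyapunov hM0.le _
  have hW0 : 0 ≤ W k := (norm_nonneg _).trans hnorm
  have hab : √(2 * p * (2 * q)) = 2 * √(p * q) := by
    rw [show 2 * p * (2 * q) = 2 ^ 2 * (p * q) by ring, Real.sqrt_mul (by norm_num),
      Real.sqrt_sq (by norm_num)]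
  have hdiv : √(2 * p / (2 * q)) = (√(q / p))⁻¹ := by
    rw [mul_div_mul_left _ _ two_ne_zero, ← Real.sqrt_inv, inv_div]
  have hpq : 0 < √(p * q) := Real.sqrt_pos.2 (by positivity)
  have hrate : √(2 * p * (2 * q)) / ξ * η * k = θ * η * √(p * q) * k := by
    rw [hab, hθdef]; ring
  have htime : ξ * Real.pi / (2 * η * √(2 * p * (2 * q))) =
      Real.pi / 2 / (θ * η * √(p * q)) := by
    rw [hab, hθdef]; field_simp
  have hh : 0 < θ * η * √(p * q) := by positivity
  rw [hrate, hdiv, kStar, htime, Nat.lt_ceil, Nat.ceil_le, lt_div_iff₀ hh, div_le_iff₀ hh,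
    mul_comm (k : ℝ)]
  set φ := θ * η * √(p * q) * k with hφ
  have hφ0 : 0 ≤ φ := by positivity
  refine ⟨fun hk0 hk => ?_, fun hk => ?_⟩
  · rcases hWk with h | h
    · have htan : 0 ≤ Real.tan (Real.pi / 2 - φ) :=
        Real.tan_nonneg_of_nonneg_of_le_pi_div_two (by linarith) (by linarith)
      have : 0 ≤ ((√(q / p))⁻¹ * Real.tan (Real.pi / 2 - φ)) ^ (ξ / 2) := by positivity
      linarith
    -- `k = 0` must be excluded: the angle would be `π/2`, where `Real.tan` has the default value 0.
    · have hφ1 : 0 < φ := mul_pos hh (Nat.cast_pos.2 hk0)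
      have h1 := lt_tan_rpow_of_arctan_lt (Real.sqrt_pos.2 (by positivity)) hW0 hθ
        (by linarith) h
      rw [hθdef, inv_div] at h1
      linarith
  -- From `k*` on the arctangent bound is nonpositive, so only the alternative `W k < ε` survives.
  · rcases hWk with h | h
    · exact hnorm.trans_lt h
    · have h1 : 0 ≤ Real.arctan (√(q / p) * W k ^ θ) := Real.arctan_nonneg.2 (by positivity)
      linarith

end

end MVIP

theorem corollary2 {E : Type*} [NormedAddCommGroup E] [InnerProductSpace ℝ E]
    [FiniteDimensional ℝ E] (F : E → E) (g : E → EReal) (μ L κ₁ κ₂ : ℝ)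
    (hg : MVIP.IsProperLscConvex g)
    (hmono : MVIP.StronglyMonotoneOn F (MVIP.dom g) μ)
    (hlip : MVIP.IsLipschitz F L)
    (hκ₁ : 0 < κ₁) (hκ₂ : 0 < κ₂) :
    ∃ xs : E, MVIP.IsMVISolution F g xs ∧ (∀ z, MVIP.IsMVISolution F g z → z = xs) ∧
      ∀ lam : ℝ, 0 < lam → lam < 2 * μ / L ^ 2 →
        ∃ ξ a b : ℝ, 2 < ξ ∧ 0 < a ∧ 0 < b ∧
          ∀ (x₀ : E) (ε : ℝ), 0 < ε →
            ∃ ηs : ℝ, 0 < ηs ∧ ∀ η : ℝ, 0 < η → η ≤ ηs →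
              ∀ x : ℕ → E,
                MVIP.IsEulerSolution F g lam κ₁ κ₂ (1 - 2 / ξ) (1 + 2 / ξ) η x₀ x →
                (∀ k : ℕ, 0 < k → k < MVIP.kStar ξ a b η →
                  ‖x k - xs‖ < Real.sqrt 2 *
                    (Real.sqrt (a / b) *
                      Real.tan (Real.pi / 2 - Real.sqrt (a * b) / ξ * η * k)) ^ (ξ / 2) + ε) ∧
                (∀ k : ℕ, MVIP.kStar ξ a b η ≤ k → ‖x k - xs‖ < ε) := by
  obtain ⟨xs, hxs⟩ := MVIP.exists_isMVISolution hg hmono hlip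
  refine ⟨xs, hxs, fun z hz => hz.unique hg hmono hxs, fun lam hlam hlam' => ?_⟩
  -- Any `ξ > 2` would serve.
  have hξ : (2 : ℝ) < 3 := by norm_num
  obtain ⟨a, b, ha, hb, H⟩ :=
    MVIP.exists_fixedTime_bound hg hmono hlip hκ₁ hκ₂ hlam hlam' hξ hxs
  refine ⟨3, a, b, hξ, ha, hb, fun x₀ ε hε => ?_⟩
  obtain ⟨ηs, hηs, H⟩ := H x₀ ε hε
  refine ⟨ηs, hηs, fun η hη hηle x hx => ⟨fun k hk0 hk => ?_, fun k => (H η hη hηle x hx k).2⟩⟩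
  refine ((H η hη hηle x hx k).1 hk0 hk).trans_le (add_le_add_left ?_ ε)
  have htan : 0 ≤ Real.tan (Real.pi / 2 - √(a * b) / 3 * η * k) := by
    have hab : 0 < √(a * b) := Real.sqrt_pos.2 (mul_pos ha hb)
    rw [MVIP.kStar, Nat.lt_ceil, lt_div_iff₀ (by positivity)] at hk
    have h : 0 ≤ √(a * b) / 3 * η * k := by positivity
    exact Real.tan_nonneg_of_nonneg_of_le_pi_div_two (by linarith) (by linarith)
  -- The factor `√2` only weakens the bound, the tangent being nonnegative before `k*`.
  exact le_mul_of_one_le_left (by positivity) (Real.one_le_sqrt.2 one_le_two)
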